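/- Let $M = (m_{i,j})$ be an $n \times n$ real matrix with non-negative entries and $\operatorname{per}(M) > 0$, where $\operatorname{per}(M) = \sum_{f \in S_n} \prod_{i=1}^{n} m_{i,f(i)}$ denotes the permanent. Let $Q = (q_{i,j})$ be an $n \times n$ doubly-stochastic matrix (that is, a matrix with non-negative real entries in which every row and every column sums to $1$) such that $q_{i,j} = 0$ whenever $m_{i,j} = 0$. Then $$\log_2 \operatorname{per}(M) \;\ge\; \log_2\!\left(\frac{n!}{n^n}\right) + \sum_{i,j=1}^{n} \left(- q_{i,j} \log_2 \frac{q_{i,j}}{m_{i,j}}\right),$$ where the expressions $0 \cdot \log_2 0$ and $0 \cdot \log_2 \frac{0}{0}$ are both understood to be $0$. -/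

import Mathlib

/-!
Gurvits' capacity method. Call `K` a capacity bound for `M` if `K * ∏ j, x j ≤ ∏ i, ∑ j, M i j * x j`
for every positive vector `x`. Two facts give the theorem.

* Weighted AM-GM in every row, together with the unit column sums of `Q`, shows that
  `∏ i, ∏ j, (M i j / Q i j) ^ Q i j` is a capacity bound (`prod_rpow_mul_prod_le_prod_sum`). Its
  logarithm is the entropy sum.
* Every capacity bound satisfies `K * (n! / n ^ n) ≤ per M` (`mul_factorial_div_pow_le_permanent`).

For the second fact, first let all entries of `M` be positive; the general case follows by adding
`ε > 0` to every entry and letting `ε → 0`. Take one variable for each row, start with the monomial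
`∏ i, X i`, and differentiate it successively in the directions of the columns of `M`. The value at
`∑ j, x j • (column j)` is at first `∏ i, ∑ j, M i j * x j`, and after all `n` derivatives the
permanent is left. It remains to see that the derivative that lowers the degree from `k + 1` to `k`
costs a factor of at most `(k / (k + 1)) ^ k` in the capacity bound, as these factors multiply to
`n! / n ^ n`. This is a statement about the restriction of the polynomial to a line with positive
direction: a polynomial of degree `k + 1` with only negative real roots that is at least `K * t` at
every `t > 0` has derivative at least `K * (k / (k + 1)) ^ k` at `0`, by AM-GM
(`Polynomial.Splits.mul_pow_le_eval_derivative_zero`).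

The restrictions are real-rooted because the polynomials are stable, that is, without zeros having
all coordinates in the open upper half-plane. The Gauss-Lucas theorem shows that stability survives
the derivative in a positive direction (`IsHyperbolicPositive.directionalDeriv`). Working with row
variables avoids setting a variable to zero, so that no limit of stable polynomials is needed.
-/

/-! ### Directional derivatives and restrictions to lines -/

/-- The derivative of a polynomial in the direction of the vector `c`. -/
noncomputable def directionalDeriv {ι : Type*} (c : ι → ℝ) :
    Derivation ℝ (MvPolynomial ι ℝ) (MvPolynomial ι ℝ) :=
  MvPolynomial.mkDerivation ℝ fun i => MvPolynomial.C (c i)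

/-- The univariate polynomial `s ↦ p (z + s • c)`. The base point `z` may have coordinates in an
extension `K` of `ℝ`, while the direction `c` is real. -/
noncomputable def alongLine {ι K : Type*} [Field K] [Algebra ℝ K] (z : ι → K) (c : ι → ℝ) :
    MvPolynomial ι ℝ →ₐ[ℝ] Polynomial K :=
  MvPolynomial.aeval fun i => Polynomial.C (z i) + Polynomial.C (algebraMap ℝ K (c i)) * Polynomial.X

section AlongLine

variable {ι K : Type*} [Field K] [Algebra ℝ K]

theorem eval_alongLine (z : ι → K) (c : ι → ℝ) (p : MvPolynomial ι ℝ) (s : K) :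
    (alongLine z c p).eval s = MvPolynomial.aeval (fun i => z i + algebraMap ℝ K (c i) * s) p := by
  induction p using MvPolynomial.induction_on with
  | C a =>
    simp only [alongLine, MvPolynomial.aeval_C]
    rw [IsScalarTower.algebraMap_apply ℝ K (Polynomial K)]
    simp
  | add p q hp hq => simp [hp, hq]
  | mul_X p i hp =>
    rw [map_mul, Polynomial.eval_mul, hp]
    simp [alongLine]

theorem map_alongLine (x c : ι → ℝ) (p : MvPolynomial ι ℝ) :
    (alongLine x c p).map (algebraMap ℝ K) = alongLine (fun i => algebraMap ℝ K (x i)) c p := by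
  induction p using MvPolynomial.induction_on with
  | C a =>
    simp only [alongLine, MvPolynomial.aeval_C]
    rw [IsScalarTower.algebraMap_apply ℝ K (Polynomial K)]
    simp
  | add p q hp hq => simp [hp, hq]
  | mul_X p i hp =>
    rw [map_mul, map_mul, Polynomial.map_mul, hp]
    simp [alongLine]

theorem derivative_alongLine (z : ι → K) (c : ι → ℝ) (p : MvPolynomial ι ℝ) :
    Polynomial.derivative (alongLine z c p) = alongLine z c (directionalDeriv c p) := by
  induction p using MvPolynomial.induction_on with
  | C a =>
    simp only [alongLine, MvPolynomial.aeval_C, directionalDeriv, MvPolynomial.derivation_C]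
    rw [IsScalarTower.algebraMap_apply ℝ K (Polynomial K)]
    simp
  | add p q hp hq => simp [hp, hq]
  | mul_X p i hp =>
    have hX : alongLine z c (MvPolynomial.X i) =
        Polynomial.C (z i) + Polynomial.C (algebraMap ℝ K (c i)) * Polynomial.X := by
      simp [alongLine]
    have hC : alongLine z c (MvPolynomial.C (c i)) = Polynomial.C (algebraMap ℝ K (c i)) := by
      simp only [alongLine, MvPolynomial.aeval_C]
      rw [IsScalarTower.algebraMap_apply ℝ K (Polynomial K)]
      simp
    rw [Derivation.leibniz]
    simp only [smul_eq_mul, map_mul, map_add, hX, Polynomial.derivative_mul, hp]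
    simp only [directionalDeriv, MvPolynomial.mkDerivation_X, hC]
    simp
    ring

theorem natDegree_alongLine_monomial_le_and_coeff (z : ι → K) (c : ι → ℝ) (m : ι →₀ ℕ) (r : ℝ) :
    (alongLine z c (MvPolynomial.monomial m r)).natDegree ≤ m.degree ∧
      (alongLine z c (MvPolynomial.monomial m r)).coeff m.degree =
        algebraMap ℝ K (MvPolynomial.eval c (MvPolynomial.monomial m r)) := by
  have hlin : ∀ i, (Polynomial.C (z i) +
      Polynomial.C (algebraMap ℝ K (c i)) * Polynomial.X).natDegree ≤ 1 := fun i => by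
    compute_degree
  have hprod : ∀ s : Finset ι,
      (∏ i ∈ s, (Polynomial.C (z i) +
        Polynomial.C (algebraMap ℝ K (c i)) * Polynomial.X) ^ m i).natDegree ≤ ∑ i ∈ s, m i ∧
      (∏ i ∈ s, (Polynomial.C (z i) +
        Polynomial.C (algebraMap ℝ K (c i)) * Polynomial.X) ^ m i).coeff (∑ i ∈ s, m i) =
        ∏ i ∈ s, algebraMap ℝ K (c i) ^ m i := by
    classical
    intro s
    induction s using Finset.induction_on with
    | empty => simp
    | insert i s hi ih =>
      have h1 : ((Polynomial.C (z i) +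
          Polynomial.C (algebraMap ℝ K (c i)) * Polynomial.X) ^ m i).natDegree ≤ m i := by
        simpa using Polynomial.natDegree_pow_le_of_le (m i) (hlin i)
      have h2 : ((Polynomial.C (z i) +
          Polynomial.C (algebraMap ℝ K (c i)) * Polynomial.X) ^ m i).coeff (m i) =
          algebraMap ℝ K (c i) ^ m i := by
        have := Polynomial.coeff_pow_of_natDegree_le (m := m i) (hlin i)
        rw [mul_one] at this
        rw [this]
        simp
      rw [Finset.prod_insert hi, Finset.sum_insert hi, Finset.prod_insert hi]
      exact ⟨Polynomial.natDegree_mul_le_of_le h1 ih.1, by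
        rw [Polynomial.coeff_mul_add_eq_of_natDegree_le h1 ih.1, h2, ih.2]⟩
  have hC : algebraMap ℝ (Polynomial K) r = Polynomial.C (algebraMap ℝ K r) := by
    rw [IsScalarTower.algebraMap_apply ℝ K (Polynomial K)]
    simp
  obtain ⟨h1, h2⟩ := hprod m.support
  have hdeg : m.degree = ∑ i ∈ m.support, m i := rfl
  rw [alongLine, MvPolynomial.aeval_monomial, MvPolynomial.eval_monomial, hC, Finsupp.prod,
    Finsupp.prod, hdeg]
  refine ⟨(Polynomial.natDegree_C_mul_le _ _).trans h1, ?_⟩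
  rw [Polynomial.coeff_C_mul, h2]
  simp

/-- The top coefficient of a homogeneous polynomial along a line is its value at the direction, so
that the degree does not drop if this value is nonzero. -/
theorem MvPolynomial.IsHomogeneous.alongLine_natDegree_le_and_coeff {p : MvPolynomial ι ℝ} {k : ℕ}
    (hp : p.IsHomogeneous k) (z : ι → K) (c : ι → ℝ) :
    (alongLine z c p).natDegree ≤ k ∧
      (alongLine z c p).coeff k = algebraMap ℝ K (MvPolynomial.eval c p) := by
  have hdeg : ∀ m ∈ p.support, m.degree = k := fun m hm =>
    (hp.degree_eq_sum_deg_support hm).symm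
  rw [p.as_sum]
  simp only [map_sum, Polynomial.finsetSum_coeff]
  refine ⟨Polynomial.natDegree_sum_le_of_forall_le _ _ fun m hm => ?_,
    Finset.sum_congr rfl fun m hm => ?_⟩
  · exact (natDegree_alongLine_monomial_le_and_coeff z c m _).1.trans (hdeg m hm).le
  · rw [← hdeg m hm]
    exact (natDegree_alongLine_monomial_le_and_coeff z c m _).2

end AlongLine

theorem MvPolynomial.IsHomogeneous.directionalDeriv {ι : Type*} [Fintype ι]
    {p : MvPolynomial ι ℝ} {k : ℕ} (hp : p.IsHomogeneous (k + 1)) (c : ι → ℝ) :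
    (directionalDeriv c p).IsHomogeneous k := by
  classical
  have hsum : ∀ q : MvPolynomial ι ℝ, (∑ i, c i • MvPolynomial.pderiv i :
      Derivation ℝ (MvPolynomial ι ℝ) (MvPolynomial ι ℝ)) q =
        ∑ i, c i • MvPolynomial.pderiv i q := by
    intro q
    have := congrFun (map_sum Derivation.coeFnAddMonoidHom
      (fun i : ι => c i • (MvPolynomial.pderiv i : Derivation ℝ (MvPolynomial ι ℝ) _))
      Finset.univ) q
    rw [Finset.sum_apply] at this
    exact this
  have h : _root_.directionalDeriv c = ∑ i, c i • MvPolynomial.pderiv i := by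
    refine MvPolynomial.derivation_ext fun j => ?_
    rw [hsum, _root_.directionalDeriv, MvPolynomial.mkDerivation_X, Finset.sum_eq_single j]
    · simp [MvPolynomial.smul_eq_C_mul]
    · intro i _ hij
      simp [MvPolynomial.pderiv_X_of_ne hij.symm]
    · simp
  rw [h, hsum]
  refine MvPolynomial.IsHomogeneous.sum _ _ _ fun i _ => ?_
  rw [MvPolynomial.smul_eq_C_mul]
  simpa using (MvPolynomial.isHomogeneous_C ι (c i)).mul (hp.pderiv (i := i))

theorem Multiset.sum_map_one_div_zero_sub_pos {s : Multiset ℝ} (hs : ∀ r ∈ s, r < 0) (h0 : s ≠ 0) :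
    0 < (s.map fun r => 1 / (0 - r)).sum := by
  have := Multiset.sum_lt_sum_of_nonempty (s := s) (f := fun _ => (0 : ℝ))
    (g := fun r => 1 / (0 - r)) h0 fun r hr => one_div_pos.2 (by linarith [hs r hr])
  simpa using this

/-! ### Stable polynomials -/

/-- A homogeneous real polynomial of degree `k` that is positive on the open positive orthant and
stable: it has no complex zero all of whose coordinates lie in the open upper half-plane. -/
structure IsHyperbolicPositive {ι : Type*} (p : MvPolynomial ι ℝ) (k : ℕ) : Prop where
  homogeneous : p.IsHomogeneous k
  pos : ∀ x : ι → ℝ, (∀ i, 0 < x i) → 0 < MvPolynomial.eval x p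
  stable : ∀ z : ι → ℂ, (∀ i, 0 < (z i).im) → MvPolynomial.aeval z p ≠ 0

namespace IsHyperbolicPositive

variable {ι : Type*} {p : MvPolynomial ι ℝ} {k : ℕ}

theorem natDegree_alongLine {K : Type*} [Field K] [Algebra ℝ K] (hp : IsHyperbolicPositive p k)
    (z : ι → K) {c : ι → ℝ} (hc : ∀ i, 0 < c i) : (alongLine z c p).natDegree = k := by
  obtain ⟨h1, h2⟩ := hp.homogeneous.alongLine_natDegree_le_and_coeff z c
  refine Polynomial.natDegree_eq_of_le_of_coeff_ne_zero h1 ?_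
  rw [h2]
  simpa using (hp.pos c hc).ne'

/-- A root in the upper half-plane of the restriction to a real line with positive direction would
be a zero excluded by stability, and nonreal roots come in conjugate pairs. -/
theorem splits_alongLine (hp : IsHyperbolicPositive p k) (x : ι → ℝ) {c : ι → ℝ}
    (hc : ∀ i, 0 < c i) : (alongLine x c p).Splits := by
  have hmap : ∀ w : ℂ, ((alongLine x c p).map (algebraMap ℝ ℂ)).eval w =
      MvPolynomial.aeval (fun i => (x i : ℂ) + c i * w) p := by
    intro w
    rw [map_alongLine, eval_alongLine]
    simp
  have him : ∀ w : ℂ, ((alongLine x c p).map (algebraMap ℝ ℂ)).eval w = 0 → w.im ≤ 0 := by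
    intro w hw
    by_contra! h
    exact hp.stable _ (fun i => by simpa using mul_pos (hc i) h) ((hmap w).symm.trans hw)
  refine (IsAlgClosed.splits _).of_splits_map (algebraMap ℝ ℂ) fun w hw => ?_
  have hw0 : ((alongLine x c p).map (algebraMap ℝ ℂ)).eval w = 0 := (Polynomial.mem_roots'.1 hw).2
  have hconj : ((alongLine x c p).map (algebraMap ℝ ℂ)).eval (starRingEnd ℂ w) = 0 := by
    rw [Polynomial.eval_map_algebraMap] at hw0 ⊢
    rw [Polynomial.aeval_conj, hw0, map_zero]
  have h1 := him w hw0
  have h2 := him _ hconj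
  rw [Complex.conj_im] at h2
  exact ⟨w.re, Complex.ext rfl (by simp; linarith)⟩

theorem roots_alongLine_neg (hp : IsHyperbolicPositive p k) {x c : ι → ℝ} (hx : ∀ i, 0 < x i)
    (hc : ∀ i, 0 < c i) : ∀ r ∈ (alongLine x c p).roots, r < 0 := by
  intro r hr
  by_contra! h
  have h0 : (alongLine x c p).eval r = 0 := (Polynomial.mem_roots'.1 hr).2
  rw [eval_alongLine] at h0
  exact (hp.pos (fun i => x i + c i * r)
    fun i => add_pos_of_pos_of_nonneg (hx i) (mul_nonneg (hc i).le h)).ne' h0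

/-- Stability is inherited by Gauss-Lucas: for `z` in the product of upper half-planes, all roots of
`s ↦ p (z + s • c)` lie in the open lower half-plane, hence so do the roots of its derivative, and
`0` is not among them. Positivity is inherited because a real-rooted polynomial with negative roots
has a positive logarithmic derivative at `0`. -/
protected theorem directionalDeriv [Fintype ι] (hp : IsHyperbolicPositive p (k + 1)) {c : ι → ℝ}
    (hc : ∀ i, 0 < c i) : IsHyperbolicPositive (directionalDeriv c p) k where
  homogeneous := hp.homogeneous.directionalDeriv c
  pos x hx := by
    have hs := hp.splits_alongLine x hc
    have hR0 : 0 < (alongLine x c p).eval 0 := by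
      rw [eval_alongLine]
      simpa using hp.pos x hx
    have hdiv := hs.eval_derivative_div_eval_of_ne_zero hR0.ne'
    have hD : (alongLine x c p).derivative.eval 0 = MvPolynomial.eval x (directionalDeriv c p) := by
      rw [derivative_alongLine, eval_alongLine]
      simp
    rw [hD] at hdiv
    have hpos : 0 < ((alongLine x c p).roots.map fun z => 1 / (0 - z)).sum := by
      refine Multiset.sum_map_one_div_zero_sub_pos (hp.roots_alongLine_neg hx hc) ?_
      exact hs.roots_ne_zero (by rw [hp.natDegree_alongLine x hc]; omega)
    rw [← hdiv] at hpos
    exact (div_pos_iff_of_pos_right hR0).1 hpos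
  stable z hz h0 := by
    have hdeg := hp.natDegree_alongLine z hc
    set f := alongLine z c p with hf
    have hroot : ∀ w ∈ f.rootSet ℂ, w.im < 0 := by
      intro w hw
      by_contra! h
      have hw0 : f.eval w = 0 := by simpa using (Polynomial.mem_rootSet.1 hw).2
      rw [hf, eval_alongLine] at hw0
      refine hp.stable _ (fun i => ?_) hw0
      simpa using add_pos_of_pos_of_nonneg (hz i) (mul_nonneg (hc i).le h)
    have hd0 : f.derivative ≠ 0 := fun h => by
      have := Polynomial.derivative_eq_zero.1 h
      omega
    have hmem : (0 : ℂ) ∈ f.derivative.rootSet ℂ := by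
      rw [Polynomial.mem_rootSet]
      refine ⟨hd0, ?_⟩
      rw [Polynomial.coe_aeval_eq_eval, hf, derivative_alongLine, eval_alongLine]
      simpa using h0
    have hlt := convexHull_min (fun w hw => hroot w hw) (convex_halfSpace_im_lt 0)
      (Polynomial.rootSet_derivative_subset_convexHull_rootSet
        (Polynomial.natDegree_pos_iff_degree_pos.1 (by omega)) hmem)
    exact lt_irrefl (0 : ℝ) hlt

end IsHyperbolicPositive

/-! ### The univariate inequality -/

/-- A form of AM-GM: if `μ` is the mean of `s`, the exponential factor is `1`. -/
theorem Multiset.prod_le_pow_card_mul_exp {μ : ℝ} (hμ : 0 < μ) (s : Multiset ℝ)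
    (hs : ∀ y ∈ s, 0 ≤ y) : s.prod ≤ μ ^ s.card * Real.exp (s.sum / μ - s.card) := by
  induction s using Multiset.induction_on with
  | empty => simp
  | cons y s ih =>
    have h1 : y ≤ μ * Real.exp (y / μ - 1) := by
      have := Real.add_one_le_exp (y / μ - 1)
      calc y = μ * (y / μ - 1 + 1) := by field_simp; ring
        _ ≤ _ := by gcongr
    have h2 := ih fun z hz => hs z (Multiset.mem_cons_of_mem hz)
    have h3 : 0 ≤ s.prod := Multiset.prod_nonneg fun z hz => hs z (Multiset.mem_cons_of_mem hz)
    rw [Multiset.prod_cons, Multiset.card_cons, Multiset.sum_cons]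
    calc y * s.prod ≤ (μ * Real.exp (y / μ - 1)) * (μ ^ s.card * Real.exp (s.sum / μ - s.card)) :=
          mul_le_mul h1 h2 h3 (by positivity)
      _ = μ ^ (s.card + 1) * (Real.exp (y / μ - 1) * Real.exp (s.sum / μ - s.card)) := by ring
      _ = _ := by
        rw [← Real.exp_add]
        congr 2
        push_cast
        ring

/-- With `y = -1 / r` for the roots `r`, `R t = R 0 * ∏ (1 + t * y)`, and `σ = ∑ y` is the logarithmic
derivative of `R` at `0`. AM-GM bounds `R t / t` by `R 0 * (1 + t * σ / (k + 1)) ^ (k + 1) / t`, and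
the choice of `t` minimizes this. -/
theorem Polynomial.Splits.mul_pow_le_eval_derivative_zero {R : Polynomial ℝ} (hR : R.Splits)
    {k : ℕ} (hk : 0 < k) (hdeg : R.natDegree = k + 1) (hroots : ∀ r ∈ R.roots, r < 0)
    (hR0 : 0 < R.eval 0) {K : ℝ} (hK : ∀ t, 0 < t → K * t ≤ R.eval t) :
    K * ((k : ℝ) / (k + 1)) ^ k ≤ R.derivative.eval 0 := by
  have hdiv := hR.eval_derivative_div_eval_of_ne_zero hR0.ne'
  set σ := (R.roots.map fun z => 1 / (0 - z)).sum with hσ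
  have hcard : R.roots.card = k + 1 := by rw [← hR.natDegree_eq_card_roots, hdeg]
  have hσpos : 0 < σ :=
    Multiset.sum_map_one_div_zero_sub_pos hroots (hR.roots_ne_zero (by omega))
  have hk' : (0 : ℝ) < k := by exact_mod_cast hk
  -- The bound on `R t / t` is least where `t * σ = (k + 1) / k`; there the mean of the factors
  -- `1 + t * y` is `(k + 1) / k` as well.
  set μ : ℝ := (k + 1) / k with hμdef
  have hμ : 0 < μ := by positivity
  set t : ℝ := μ / σ with ht
  have htpos : 0 < t := by positivity
  have heval : R.eval t = R.eval 0 * (R.roots.map fun z => 1 + t * (1 / (0 - z))).prod := by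
    rw [hR.eval_eq_prod_roots, hR.eval_eq_prod_roots, mul_assoc, ← Multiset.prod_map_mul]
    congr 2
    refine Multiset.map_congr rfl fun r hr => ?_
    have := hroots r hr
    have : 0 - r ≠ 0 := by linarith
    field_simp
    ring
  have hamgm := Multiset.prod_le_pow_card_mul_exp hμ (R.roots.map fun z => 1 + t * (1 / (0 - z)))
    (by
      intro y hy
      obtain ⟨r, hr, rfl⟩ := Multiset.mem_map.1 hy
      have : 0 < 1 / (0 - r) := one_div_pos.2 (by linarith [hroots r hr])
      positivity)
  have hsum : (R.roots.map fun z => 1 + t * (1 / (0 - z))).sum = (k + 1) + t * σ := by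
    rw [Multiset.sum_map_add, Multiset.sum_map_mul_left]
    simp [hcard, hσ, add_comm]
  have hexp : ((k + 1) + t * σ) / μ - ((k + 1 : ℕ) : ℝ) = 0 := by
    rw [ht, div_mul_cancel₀ _ hσpos.ne', hμdef]
    push_cast
    field_simp
    ring
  rw [Multiset.card_map, hcard, hsum, hexp, Real.exp_zero, mul_one] at hamgm
  have h1 : K * t ≤ R.eval 0 * μ ^ (k + 1) :=
    (hK t htpos).trans (heval.trans_le (mul_le_mul_of_nonneg_left hamgm hR0.le))
  have h2 : R.derivative.eval 0 = R.eval 0 * σ := by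
    rw [← hdiv]; field_simp
  have h3 : (k : ℝ) / (k + 1) = μ⁻¹ := by rw [hμdef, inv_div]
  rw [h2, h3, inv_pow, ← div_eq_mul_inv, div_le_iff₀ (by positivity)]
  have h4 : K * μ ≤ (R.eval 0 * σ * μ ^ k) * μ := by
    have h5 : K * μ = K * t * σ := by rw [ht]; field_simp
    rw [h5]
    calc K * t * σ ≤ (R.eval 0 * μ ^ (k + 1)) * σ := by gcongr
      _ = _ := by ring
  exact le_of_mul_le_mul_right h4 hμ

/-! ### Iterated derivatives and capacity -/

/-- The successive derivatives in the directions `c 0`, `c 1`, …, as a linear map. -/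
noncomputable def iteratedDirectionalDeriv {ι : Type*} :
    {k : ℕ} → (Fin k → ι → ℝ) → MvPolynomial ι ℝ →ₗ[ℝ] MvPolynomial ι ℝ
  | 0, _ => LinearMap.id
  | _ + 1, c => iteratedDirectionalDeriv (Fin.tail c) ∘ₗ (directionalDeriv (c 0)).toLinearMap

/-- Gurvits' capacity inequality: for `p` of degree `k`, a lower bound `K * ∏ j, x j` for `p` on the
open cone spanned by `k` positive directions bounds the mixed derivative in these directions from
below. After all derivatives a constant is left, so the point of evaluation is immaterial. -/
theorem IsHyperbolicPositive.capacity_le {ι : Type*} [Fintype ι] {k : ℕ} {p : MvPolynomial ι ℝ}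
    (hp : IsHyperbolicPositive p k) (c : Fin k → ι → ℝ) (hc : ∀ j i, 0 < c j i) {K : ℝ}
    (hK : ∀ x : Fin k → ℝ, (∀ j, 0 < x j) →
      K * ∏ j, x j ≤ MvPolynomial.eval (∑ j, x j • c j) p) :
    K * ((k.factorial : ℝ) / (k : ℝ) ^ k) ≤
      MvPolynomial.eval 0 (iteratedDirectionalDeriv c p) := by
  induction k generalizing p K with
  | zero =>
    have := hK 0 (fun j => j.elim0)
    simpa [iteratedDirectionalDeriv] using this
  | succ k ih =>
    have hline : ∀ (x : ι → ℝ) (t : ℝ), (alongLine x (c 0) p).eval t =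
        MvPolynomial.eval (x + t • c 0) p := by
      intro x t
      rw [eval_alongLine, MvPolynomial.aeval_eq_eval]
      congr 2
      ext i
      simp [mul_comm]
    have hderiv : ∀ x : ι → ℝ, (alongLine x (c 0) p).derivative.eval 0 =
        MvPolynomial.eval x (directionalDeriv (c 0) p) := by
      intro x
      rw [derivative_alongLine, eval_alongLine]
      simp
    have hp' := hp.directionalDeriv (hc 0)
    rcases Nat.eq_zero_or_pos k with rfl | hk
    -- For degree `1` the base point is the empty sum `0`, which is not positive; but then the
    -- derivative in the direction `c 0` is the value at `c 0`.
    · have h1 := hK (fun _ => 1) (fun _ => one_pos)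
      obtain ⟨-, h3⟩ := hp.homogeneous.alongLine_natDegree_le_and_coeff (0 : ι → ℝ) (c 0)
      have h4 := hderiv 0
      rw [← Polynomial.coeff_zero_eq_eval_zero, Polynomial.coeff_derivative] at h4
      simp only [zero_add] at h3 h4
      rw [h3] at h4
      change _ ≤ MvPolynomial.eval 0 (directionalDeriv (c 0) p)
      rw [← h4]
      simpa using h1
    · have hstep : ∀ x : Fin k → ℝ, (∀ j, 0 < x j) →
          (K * ((k : ℝ) / (k + 1)) ^ k) * ∏ j, x j ≤
            MvPolynomial.eval (∑ j, x j • Fin.tail c j) (directionalDeriv (c 0) p) := by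
        intro x hx
        set a := ∑ j, x j • Fin.tail c j with ha
        have hapos : ∀ i, 0 < a i := by
          intro i
          rw [ha, Finset.sum_apply]
          exact Finset.sum_pos (fun j _ => mul_pos (hx j) (hc _ i)) ⟨⟨0, hk⟩, Finset.mem_univ _⟩
        have := (hp.splits_alongLine a (hc 0)).mul_pow_le_eval_derivative_zero hk
          (hp.natDegree_alongLine a (hc 0)) (hp.roots_alongLine_neg hapos (hc 0))
          (by rw [hline]; simpa using hp.pos a hapos) (K := K * ∏ j, x j) (by
            intro t ht
            have h := hK (Fin.cons t x) (fun j => by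
              refine Fin.cases ?_ (fun j => ?_) j
              · simpa using ht
              · simpa using hx j)
            rw [Fin.prod_univ_succ, Fin.sum_univ_succ] at h
            simp only [Fin.cons_zero, Fin.cons_succ] at h
            rw [hline, add_comm a]
            calc K * (∏ j, x j) * t = K * (t * ∏ j, x j) := by ring
              _ ≤ _ := h)
        rw [hderiv] at this
        calc _ = K * (∏ j, x j) * ((k : ℝ) / (k + 1)) ^ k := by ring
          _ ≤ _ := this
      have := ih hp' (Fin.tail c) (fun j i => hc _ i) hstep
      refine le_trans (le_of_eq ?_) this
      have hk' : (0 : ℝ) < k := by exact_mod_cast hk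
      rw [Nat.factorial_succ, div_pow]
      push_cast
      field_simp
      ring

/-! ### The permanent -/

theorem directionalDeriv_prod_X {ι : Type*} [DecidableEq ι] (c : ι → ℝ) (S : Finset ι) :
    directionalDeriv c (∏ i ∈ S, MvPolynomial.X i) =
      ∑ i ∈ S, c i • ∏ l ∈ S.erase i, MvPolynomial.X l := by
  induction S using Finset.induction_on with
  | empty => simp
  | insert a S ha ih =>
    rw [Finset.prod_insert ha, Derivation.leibniz, ih, Finset.sum_insert ha,
      Finset.erase_insert ha, add_comm, Finset.smul_sum]
    congr 1
    · simp [directionalDeriv, MvPolynomial.smul_eq_C_mul, mul_comm]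
    · refine Finset.sum_congr rfl fun i hi => ?_
      have hai : a ≠ i := fun h => ha (h ▸ hi)
      rw [Finset.erase_insert_of_ne hai,
        Finset.prod_insert fun h => ha (Finset.mem_of_mem_erase h), smul_comm, smul_eq_mul]

/-- By the Leibniz rule every derivative removes one variable, so the terms correspond to the
injections of the index set of the directions into `S`. -/
theorem eval_iteratedDirectionalDeriv_prod_X {ι : Type*} [Fintype ι] [DecidableEq ι] {k : ℕ}
    (c : Fin k → ι → ℝ) (S : Finset ι) (hS : S.card = k) :
    MvPolynomial.eval 0 (iteratedDirectionalDeriv c (∏ i ∈ S, MvPolynomial.X i)) =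
      ∑ f : Fin k → ι, if Function.Injective f ∧ ∀ j, f j ∈ S then ∏ j, c j (f j) else 0 := by
  induction k generalizing S with
  | zero =>
    obtain rfl := Finset.card_eq_zero.1 hS
    simp [iteratedDirectionalDeriv, Function.injective_of_subsingleton]
  | succ k ih =>
    change MvPolynomial.eval 0 (iteratedDirectionalDeriv (Fin.tail c)
      (directionalDeriv (c 0) (∏ i ∈ S, MvPolynomial.X i))) = _
    rw [directionalDeriv_prod_X, map_sum, map_sum, ← (Fin.consEquiv fun _ => ι).sum_comp,
      Fintype.sum_prod_type, ← Finset.sum_subset (Finset.subset_univ S)]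
    · refine Finset.sum_congr rfl fun i hi => ?_
      rw [map_smul, MvPolynomial.smul_eval, ih _ _ (by rw [Finset.card_erase_of_mem hi]; omega),
        Finset.mul_sum]
      refine Finset.sum_congr rfl fun g _ => ?_
      have hiff : (Function.Injective (Fin.cons i g : Fin (k + 1) → ι) ∧
          ∀ j, (Fin.cons i g : Fin (k + 1) → ι) j ∈ S) ↔
          Function.Injective g ∧ ∀ j, g j ∈ S.erase i := by
        rw [Fin.cons_injective_iff, Fin.forall_fin_succ]
        simp only [Fin.cons_zero, Fin.cons_succ, Finset.mem_erase, Set.mem_range, not_exists]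
        grind
      change _ = if Function.Injective (Fin.cons i g : Fin (k + 1) → ι) ∧
          ∀ j, (Fin.cons i g : Fin (k + 1) → ι) j ∈ S then
        ∏ j, c j ((Fin.cons i g : Fin (k + 1) → ι) j) else 0
      simp only [hiff, Fin.prod_univ_succ, Fin.cons_zero, Fin.cons_succ, mul_ite, mul_zero]
      rfl
    · intro i _ hi
      refine Finset.sum_eq_zero fun g _ => if_neg fun h => hi ?_
      simpa [Fin.consEquiv] using h.2 0

theorem eval_iteratedDirectionalDeriv_col_eq_permanent {n : ℕ} (M : Matrix (Fin n) (Fin n) ℝ) :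
    MvPolynomial.eval 0 (iteratedDirectionalDeriv (fun j i => M i j)
      (∏ i, MvPolynomial.X i)) = M.permanent := by
  rw [eval_iteratedDirectionalDeriv_prod_X _ _ (by simp), Matrix.permanent,
    ← Finset.sum_filter]
  symm
  refine Finset.sum_bij (fun σ _ => (σ : Fin n → Fin n)) (by simp [Equiv.injective])
    (fun σ _ τ _ h => DFunLike.coe_injective h) (fun f hf => ?_) (fun _ _ => rfl)
  have hf' : Function.Injective f := by simpa using hf
  exact ⟨Equiv.ofBijective f (Finite.injective_iff_bijective.1 hf'), by simp, rfl⟩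

theorem isHyperbolicPositive_prod_X {ι : Type*} [Fintype ι] :
    IsHyperbolicPositive (∏ i : ι, (MvPolynomial.X i : MvPolynomial ι ℝ)) (Fintype.card ι) where
  homogeneous := by
    simpa using MvPolynomial.IsHomogeneous.prod (R := ℝ) Finset.univ (fun i : ι => MvPolynomial.X i)
      (fun _ => 1) (fun i _ => MvPolynomial.isHomogeneous_X ℝ i)
  pos x hx := by
    simpa [MvPolynomial.eval_prod] using Finset.prod_pos fun i _ => hx i
  stable z hz := by
    rw [map_prod]
    refine Finset.prod_ne_zero_iff.2 fun i _ h => ?_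
    have := hz i
    rw [MvPolynomial.aeval_X] at h
    simp [h] at this

theorem mul_factorial_div_pow_le_permanent_of_pos {n : ℕ} {M : Matrix (Fin n) (Fin n) ℝ}
    (hM : ∀ i j, 0 < M i j) {K : ℝ}
    (hK : ∀ x : Fin n → ℝ, (∀ j, 0 < x j) → K * ∏ j, x j ≤ ∏ i, ∑ j, M i j * x j) :
    K * ((n.factorial : ℝ) / (n : ℝ) ^ n) ≤ M.permanent := by
  rw [← eval_iteratedDirectionalDeriv_col_eq_permanent]
  have h := isHyperbolicPositive_prod_X (ι := Fin n)
  rw [Fintype.card_fin] at h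
  refine h.capacity_le _ (fun j i => hM i j) fun x hx => ?_
  refine (hK x hx).trans (le_of_eq ?_)
  rw [MvPolynomial.eval_prod]
  simp [Finset.sum_apply, mul_comm]

theorem mul_factorial_div_pow_le_permanent {n : ℕ} {M : Matrix (Fin n) (Fin n) ℝ}
    (hM : ∀ i j, 0 ≤ M i j) {K : ℝ}
    (hK : ∀ x : Fin n → ℝ, (∀ j, 0 < x j) → K * ∏ j, x j ≤ ∏ i, ∑ j, M i j * x j) :
    K * ((n.factorial : ℝ) / (n : ℝ) ^ n) ≤ M.permanent := by
  have hcont : Continuous fun ε : ℝ => (Matrix.of fun i j => M i j + ε).permanent := by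
    simp only [Matrix.permanent, Matrix.of_apply]
    fun_prop
  have hlim : Filter.Tendsto (fun ε : ℝ => (Matrix.of fun i j => M i j + ε).permanent)
      (nhdsWithin 0 (Set.Ioi 0)) (nhds M.permanent) := by
    have := (hcont.tendsto 0).mono_left (nhdsWithin_le_nhds (s := Set.Ioi 0))
    simpa using! this
  refine ge_of_tendsto hlim (eventually_nhdsWithin_of_forall fun ε hε => ?_)
  have hε : 0 < ε := hε
  refine mul_factorial_div_pow_le_permanent_of_pos
    (fun i j => add_pos_of_nonneg_of_pos (hM i j) hε) fun x hx => (hK x hx).trans ?_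
  refine Finset.prod_le_prod (fun i _ => Finset.sum_nonneg fun j _ => mul_nonneg (hM i j) (hx j).le)
    fun i _ => Finset.sum_le_sum fun j _ => ?_
  exact mul_le_mul_of_nonneg_right (by simpa using hε.le) (hx j).le

/-! ### The entropy bound -/

/-- Weighted AM-GM in row `i` with weights `Q i j` gives
`∏ j, (M i j / Q i j * x j) ^ Q i j ≤ ∑ j, M i j * x j`; in the product over the rows, `x j` gets the
exponent `∑ i, Q i j = 1`. Where `Q i j = 0`, the division by zero is harmless, as the power is `1`. -/
theorem prod_rpow_mul_prod_le_prod_sum {n : ℕ} {M Q : Matrix (Fin n) (Fin n) ℝ}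
    (hM : ∀ i j, 0 ≤ M i j) (hQ : Q ∈ doublyStochastic ℝ (Fin n)) (x : Fin n → ℝ)
    (hx : ∀ j, 0 < x j) :
    (∏ i, ∏ j, (M i j / Q i j) ^ Q i j) * ∏ j, x j ≤ ∏ i, ∑ j, M i j * x j := by
  rw [mem_doublyStochastic_iff_sum] at hQ
  obtain ⟨hQ0, hrow, hcol⟩ := hQ
  have hx' : ∏ j, x j = ∏ i, ∏ j, x j ^ Q i j := by
    rw [Finset.prod_comm]
    refine Finset.prod_congr rfl fun j _ => ?_
    rw [← Real.rpow_sum_of_pos (hx j), hcol, Real.rpow_one]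
  rw [hx', ← Finset.prod_mul_distrib]
  refine Finset.prod_le_prod (fun i _ => ?_) fun i _ => ?_
  · exact mul_nonneg (Finset.prod_nonneg fun j _ => Real.rpow_nonneg (div_nonneg (hM i j) (hQ0 i j)) _)
      (Finset.prod_nonneg fun j _ => Real.rpow_nonneg (hx j).le _)
  · rw [← Finset.prod_mul_distrib]
    have hz : ∀ j, 0 ≤ M i j / Q i j * x j := fun j =>
      mul_nonneg (div_nonneg (hM i j) (hQ0 i j)) (hx j).le
    calc ∏ j, (M i j / Q i j) ^ Q i j * x j ^ Q i j = ∏ j, (M i j / Q i j * x j) ^ Q i j :=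
          Finset.prod_congr rfl fun j _ =>
            (Real.mul_rpow (div_nonneg (hM i j) (hQ0 i j)) (hx j).le).symm
      _ ≤ ∑ j, Q i j * (M i j / Q i j * x j) :=
          Real.geom_mean_le_arith_mean_weighted _ _ _ (fun j _ => hQ0 i j) (hrow i) fun j _ => hz j
      _ ≤ ∑ j, M i j * x j := by
          refine Finset.sum_le_sum fun j _ => ?_
          rcases (hQ0 i j).eq_or_lt with h | h
          · rw [← h]
            simpa using mul_nonneg (hM i j) (hx j).le
          · exact le_of_eq (by field_simp)

theorem mainTheorem1 (n : ℕ) (M Q : Matrix (Fin n) (Fin n) ℝ)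
    (hM : ∀ i j, 0 ≤ M i j) (hper : 0 < M.permanent)
    (hQ : Q ∈ doublyStochastic ℝ (Fin n))
    (hsupp : ∀ i j, M i j = 0 → Q i j = 0) :
    Real.logb 2 ((n.factorial : ℝ) / (n : ℝ) ^ n)
        + ∑ i, ∑ j, -(Q i j * Real.logb 2 (Q i j / M i j))
      ≤ Real.logb 2 M.permanent := by
  have hQ0 : ∀ i j, 0 ≤ Q i j := (mem_doublyStochastic_iff_sum.1 hQ).1
  -- For `n = 0` this holds by `0 ^ 0 = 1`.
  have hfac : (0 : ℝ) < (n.factorial : ℝ) / (n : ℝ) ^ n := by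
    rcases Nat.eq_zero_or_pos n with rfl | hn
    · simp
    · positivity
  have hpos : ∀ i j, 0 < (M i j / Q i j) ^ Q i j := by
    intro i j
    rcases (hQ0 i j).eq_or_lt with h | h
    · simp [← h]
    · have : 0 < M i j := (hM i j).lt_of_ne' fun h0 => h.ne' (hsupp i j h0)
      positivity
  have hlog : Real.logb 2 (∏ i, ∏ j, (M i j / Q i j) ^ Q i j) =
      ∑ i, ∑ j, -(Q i j * Real.logb 2 (Q i j / M i j)) := by
    rw [Real.logb_prod _ _ fun i _ => (Finset.prod_pos fun j _ => hpos i j).ne']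
    refine Finset.sum_congr rfl fun i _ => ?_
    rw [Real.logb_prod _ _ fun j _ => (hpos i j).ne']
    refine Finset.sum_congr rfl fun j _ => ?_
    rcases (hQ0 i j).eq_or_lt with h | h
    · simp [← h]
    · have hMpos : 0 < M i j := (hM i j).lt_of_ne' fun h0 => h.ne' (hsupp i j h0)
      rw [Real.logb_rpow_eq_mul_logb_of_pos (by positivity), ← inv_div (Q i j), Real.logb_inv]
      ring
  have hA : 0 < ∏ i, ∏ j, (M i j / Q i j) ^ Q i j :=
    Finset.prod_pos fun i _ => Finset.prod_pos fun j _ => hpos i j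
  rw [← hlog, add_comm, ← Real.logb_mul hA.ne' hfac.ne']
  exact Real.logb_le_logb_of_le one_lt_two (by positivity)
    (mul_factorial_div_pow_le_permanent hM (prod_rpow_mul_prod_le_prod_sum hM hQ))
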